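/- Let $n\ge 0$, let $\mathbf E$ denote expectation with respect to the uniform probability measure on $\{-1,1\}^n$, and for $f:\{-1,1\}^n\to E$ put $$D_i f(x)=\tfrac12\bigl(f(x)-f(x_1,\dots,x_{i-1},-x_i,x_{i+1},\dots,x_n)\bigr),\qquad 1\le i\le n .$$ A Banach space $E$ has cotype $Q\in[2,\infty)$ with constant $C(E)\ge 0$ if for all $m$ and all $v_1,\dots,v_m\in E$ $$\Bigl(\sum_{i=1}^m\|v_i\|^Q\Bigr)^{1/Q}\le C(E)\,\Bigl(\mathbf E_\varepsilon\Bigl\|\sum_{i=1}^m\varepsilon_i v_i\Bigr\|^2\Bigr)^{1/2},$$ where $\varepsilon$ is uniformly distributed on $\{-1,1\}^m$. **Theorem.** There is a universal constant $C>0$ such that the following holds for every Banach space $E$ of cotype $Q$ with constant $C(E)$. For every $n$ and every $f:\{-1,1\}^n\to E$ that satisfies the Lipschitz condition $$\mathbf E_\delta\Bigl\|\sum_{i=1}^n\delta_i D_i f(x)\Bigr\|_E^2\le 1\qquad\text{for all }x\in\{-1,1\}^n$$ ($\delta$ uniformly distributed on $\{-1,1\}^n$), and every real $p\ge1$, $$\bigl(\mathbf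 E\|f-\mathbf E f\|_E^p\bigr)^{1/p}\le\begin{cases} C\,\sqrt{2p+C(E)^2Q^2-2Q}, & p\ge Q,\\[2pt] C\,C(E)\,Q, & 1\le p\le Q.\end{cases}$$ In particular, the growth is at most of order $\sqrt p$ for large $p$ in every Banach space of finite cotype: there is $p_0$, depending only on $E$, $Q$ and $C(E)$, such that $\bigl(\mathbf E\|f-\mathbf E f\|_E^p\bigr)^{1/p}\le C\sqrt p$ for all $p\ge p_0$, all $n$ and all such $f$. -/

import Mathlib

/-- The Hamming cube `{-1, 1}^n`. -/
abbrev HammingCube (n : ℕ) : Type := Fin n → ℤˣ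

noncomputable section

/-- The expectation of `g` under the uniform probability measure on `{-1, 1}^n`. -/
def cubeMean {n : ℕ} {E : Type*} [AddCommGroup E] [Module ℝ E] (g : HammingCube n → E) : E :=
  ((2 : ℝ) ^ n)⁻¹ • ∑ x : HammingCube n, g x

/-- The discrete derivative
`D_i f (x) = (f (x) - f (x_1, …, x_{i-1}, -x_i, x_{i+1}, …, x_n)) / 2`. -/
def cubeDeriv {n : ℕ} {E : Type*} [AddCommGroup E] [Module ℝ E]
    (i : Fin n) (f : HammingCube n → E) (x : HammingCube n) : E :=
  (2 : ℝ)⁻¹ • (f x - f (Function.update x i (-x i)))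

/-- `E` has (Rademacher) cotype `Q ∈ [2, ∞)` with constant `K`: for all finite families of vectors,
`(∑ ‖v_i‖ ^ Q) ^ (1 / Q) ≤ K (𝔼 ‖∑ ε_i v_i‖ ^ 2) ^ (1 / 2)`, with `ε` uniform on the signs. -/
def HasCotypeWith (E : Type*) [NormedAddCommGroup E] [NormedSpace ℝ E] (Q K : ℝ) : Prop :=
  2 ≤ Q ∧ 0 ≤ K ∧ ∀ (m : ℕ) (v : Fin m → E),
    (∑ i, ‖v i‖ ^ Q) ^ (1 / Q) ≤
      K * Real.sqrt (cubeMean fun ε : HammingCube m => ‖∑ i, ε i • v i‖ ^ 2)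

/-- The Lipschitz condition `𝔼_δ ‖∑ δ_i D_i f (x)‖ ^ 2 ≤ 1` for every point `x` of the cube. -/
def IsCubeLipschitz {n : ℕ} {E : Type*} [NormedAddCommGroup E] [NormedSpace ℝ E]
    (f : HammingCube n → E) : Prop :=
  ∀ x : HammingCube n,
    cubeMean (fun δ : HammingCube n => ‖∑ i, δ i • cubeDeriv i f x‖ ^ 2) ≤ 1

/-- The central moment `(𝔼 ‖f - 𝔼 f‖ ^ p) ^ (1 / p)`. -/
def centralMoment {n : ℕ} {E : Type*} [NormedAddCommGroup E] [NormedSpace ℝ E]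
    (f : HammingCube n → E) (p : ℝ) : ℝ :=
  (cubeMean fun x : HammingCube n => ‖f x - cubeMean f‖ ^ p) ^ (1 / p)

end

/-! The proof combines a concentration estimate valid in every normed space with a first-moment
bound, the only place where the cotype inequality enters.

Concentration: for fixed `x`, a functional norming `f x - cubeMean f` controls all decreases of `g =
‖f - cubeMean f‖` under coordinate flips by the weak ℓ² norm of the derivatives, so the one-sided
squared gradient of `g` is at most 4. The modified log-Sobolev inequality (`cube_entropy_le`) needs
only this one-sided bound, and Herbst's argument gives `‖g‖_p ≤ e³ (𝔼 g + √p)`.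

First moment (`IsCubeLipschitz.cubeMean_norm_sub_le`): multiply `x` by independent signs of mean `r`
and let `r` run from 0 (full averaging) to 1 (identity). The `r`-derivative is governed by a centred
biased-sign sum of the `D_i f`. After symmetrization this is a Rademacher sum with each term kept
with probability `(1 - r²) / 2`, and cotype makes such a sparse sum small by that probability to the
power `1 / Q` (`HasCotypeWith.productMean_selector_le`). The singularity at `r = 1` becomes `(1 - r)
^ (1 / Q - 1)`, whose integral is `Q`. -/

open Real

/-! ### Averages and coordinate flips on the cube -/

section CubeMean

variable {n : ℕ}

lemma cubeMean_real (g : HammingCube n → ℝ) : cubeMean g = ((2 : ℝ) ^ n)⁻¹ * ∑ x, g x := rfl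

lemma cubeMean_add (g h : HammingCube n → ℝ) :
    cubeMean (fun x => g x + h x) = cubeMean g + cubeMean h := by
  simp only [cubeMean_real, Finset.sum_add_distrib, mul_add]

lemma cubeMean_sub (g h : HammingCube n → ℝ) :
    cubeMean (fun x => g x - h x) = cubeMean g - cubeMean h := by
  simp only [cubeMean_real, Finset.sum_sub_distrib, mul_sub]

lemma cubeMean_const_mul (c : ℝ) (g : HammingCube n → ℝ) :
    cubeMean (fun x => c * g x) = c * cubeMean g := by
  simp only [cubeMean_real, ← Finset.mul_sum]
  ring

lemma cubeMean_mul_const (c : ℝ) (g : HammingCube n → ℝ) :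
    cubeMean (fun x => g x * c) = cubeMean g * c := by
  simp only [cubeMean_real, ← Finset.sum_mul]
  ring

lemma cubeMean_sum {ι : Type*} (s : Finset ι) (g : ι → HammingCube n → ℝ) :
    cubeMean (fun x => ∑ i ∈ s, g i x) = ∑ i ∈ s, cubeMean (g i) := by
  simp only [cubeMean_real, ← Finset.mul_sum]
  rw [Finset.sum_comm]

lemma card_hammingCube : Fintype.card (HammingCube n) = 2 ^ n := by
  simp [HammingCube]

lemma cubeMean_const (c : ℝ) : cubeMean (fun _ : HammingCube n => c) = c := by
  rw [cubeMean_real, Finset.sum_const, Finset.card_univ, card_hammingCube, nsmul_eq_mul]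
  push_cast
  rw [inv_mul_cancel_left₀ (by positivity)]

lemma cubeMean_mono {g h : HammingCube n → ℝ} (H : ∀ x, g x ≤ h x) :
    cubeMean g ≤ cubeMean h := by
  rw [cubeMean_real, cubeMean_real]
  gcongr
  exact H _

lemma cubeMean_nonneg {g : HammingCube n → ℝ} (H : ∀ x, 0 ≤ g x) : 0 ≤ cubeMean g := by
  simpa [cubeMean_const] using cubeMean_mono (g := fun _ => 0) H

lemma cubeMean_pos {g : HammingCube n → ℝ} (H : ∀ x, 0 < g x) : 0 < cubeMean g := by
  rw [cubeMean_real]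
  have : 0 < ∑ x, g x := Finset.sum_pos (fun x _ => H x) Finset.univ_nonempty
  positivity

lemma cubeMean_comp_equiv (e : HammingCube n ≃ HammingCube n) (g : HammingCube n → ℝ) :
    cubeMean (fun x => g (e x)) = cubeMean g := by
  rw [cubeMean_real, cubeMean_real, e.sum_comp]

lemma sum_intUnits {M : Type*} [AddCommMonoid M] (g : ℤˣ → M) : ∑ a, g a = g 1 + g (-1) := by
  rw [show (Finset.univ : Finset ℤˣ) = {1, -1} from rfl, Finset.sum_pair (by decide)]

lemma cubeMean_succ (g : HammingCube (n + 1) → ℝ) :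
    cubeMean g = (cubeMean (fun y : HammingCube n => g (Fin.cons 1 y)) +
      cubeMean (fun y : HammingCube n => g (Fin.cons (-1) y))) / 2 := by
  simp only [cubeMean_real]
  rw [← (Fin.consEquiv (fun _ : Fin (n + 1) => ℤˣ)).sum_comp g, Fintype.sum_prod_type,
    sum_intUnits]
  simp only [pow_succ]
  field_simp
  rfl

/-- The point obtained from `x` by changing the sign of its `i`-th coordinate. -/
def HammingCube.flip (i : Fin n) (x : HammingCube n) : HammingCube n :=
  Function.update x i (-x i)

lemma HammingCube.flip_flip (i : Fin n) (x : HammingCube n) : (x.flip i).flip i = x := by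
  simp [HammingCube.flip]

lemma HammingCube.flip_zero_cons (a : ℤˣ) (y : HammingCube n) :
    HammingCube.flip 0 (Fin.cons a y : HammingCube (n + 1)) = Fin.cons (-a) y := by
  simp [HammingCube.flip]

lemma HammingCube.flip_succ_cons (j : Fin n) (a : ℤˣ) (y : HammingCube n) :
    HammingCube.flip j.succ (Fin.cons a y : HammingCube (n + 1)) = Fin.cons a (y.flip j) := by
  simp [HammingCube.flip, Fin.cons_update]

lemma cubeMean_comp_flip (i : Fin n) (g : HammingCube n → ℝ) :
    cubeMean (fun x => g (x.flip i)) = cubeMean g :=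
  cubeMean_comp_equiv
    ⟨HammingCube.flip i, HammingCube.flip i, HammingCube.flip_flip i, HammingCube.flip_flip i⟩ g

end CubeMean

/-! ### Modified logarithmic Sobolev inequality -/

section LogSobolev

/-- Pointwise form of the variational principle for entropy: `log x ≤ x - 1` at `x = m A / (a M)`.
-/
lemma mul_log_sub_log_le {a A m M : ℝ} (ha : 0 < a) (hA : 0 < A) (hm : 0 < m) (hM : 0 < M) :
    a * (log A - log M) ≤ a * (log a - log m) + (m * A / M - a) := by
  have h := Real.log_le_sub_one_of_pos (x := m * A / (a * M)) (by positivity)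
  rw [log_div (by positivity) (by positivity), log_mul hm.ne' hA.ne', log_mul ha.ne' hM.ne'] at h
  have h2 := mul_le_mul_of_nonneg_left h ha.le
  have : a * (m * A / (a * M) - 1) = m * A / M - a := by field_simp
  linarith

lemma add_log_le_two_mul_log {a b : ℝ} (ha : 0 < a) (hb : 0 < b) :
    log a + log b ≤ 2 * log ((a + b) / 2) := by
  rw [← log_mul ha.ne' hb.ne', ← Real.log_rpow (by positivity)]
  refine log_le_log (by positivity) ?_
  norm_num
  nlinarith [sq_nonneg (a - b)]

/-- The linear corrections of the two variational bounds cancel when `m`, `M` are the midpoints;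
concavity of `log` does the rest. In the induction, `A` and `B` are the means over the two
half-cubes, so averaging over `a`, `b` leaves exactly the entropy of the pair `(A, B)`. -/
lemma two_point_entropy_le {a b A B : ℝ} (ha : 0 < a) (hb : 0 < b) (hA : 0 < A) (hB : 0 < B) :
    a * (log A - log ((A + B) / 2)) + b * (log B - log ((A + B) / 2)) ≤
      (a - b) * (log a - log b) / 2 := by
  have h1 := mul_log_sub_log_le ha hA (m := (a + b) / 2) (M := (A + B) / 2)
    (by positivity) (by positivity)
  have h2 := mul_log_sub_log_le hb hB (m := (a + b) / 2) (M := (A + B) / 2)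
    (by positivity) (by positivity)
  have h3 : (a + b) / 2 * A / ((A + B) / 2) + (a + b) / 2 * B / ((A + B) / 2) = a + b := by
    field_simp
  have h4 := mul_le_mul_of_nonneg_left (add_log_le_two_mul_log ha hb) (add_pos ha hb).le
  linarith

/-- The modified logarithmic Sobolev inequality on the Hamming cube. -/
theorem cube_entropy_le {n : ℕ} (F : HammingCube n → ℝ) (hF : ∀ x, 0 < F x) :
    cubeMean (fun x => F x * log (F x)) - cubeMean F * log (cubeMean F) ≤
      4⁻¹ * ∑ i, cubeMean fun x => (F x - F (x.flip i)) * (log (F x) - log (F (x.flip i))) := by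
  induction n with
  | zero => simp [cubeMean_real]
  | succ n ih =>
    have h1 := ih (fun y => F (Fin.cons 1 y)) (fun y => hF _)
    have h2 := ih (fun y => F (Fin.cons (-1) y)) (fun y => hF _)
    have hA := cubeMean_pos (fun y : HammingCube n => hF (Fin.cons 1 y))
    have hB := cubeMean_pos (fun y : HammingCube n => hF (Fin.cons (-1) y))
    have h3 := cubeMean_mono fun y : HammingCube n =>
      two_point_entropy_le (hF (Fin.cons 1 y)) (hF (Fin.cons (-1) y)) hA hB
    rw [cubeMean_add, cubeMean_mul_const, cubeMean_mul_const] at h3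
    simp only [div_eq_mul_inv _ (2 : ℝ)] at h3
    rw [cubeMean_mul_const] at h3
    rw [Fin.sum_univ_succ, cubeMean_succ F]
    simp only [cubeMean_succ (n := n), HammingCube.flip_zero_cons, HammingCube.flip_succ_cons,
      neg_neg]
    rw [← Finset.sum_div, Finset.sum_add_distrib]
    have h4 : cubeMean (fun y : HammingCube n => (F (Fin.cons (-1) y) - F (Fin.cons 1 y)) *
        (log (F (Fin.cons (-1) y)) - log (F (Fin.cons 1 y)))) =
        cubeMean (fun y : HammingCube n => (F (Fin.cons 1 y) - F (Fin.cons (-1) y)) *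
        (log (F (Fin.cons 1 y)) - log (F (Fin.cons (-1) y)))) := by
      congr 1; ext y; ring
    rw [h4]
    simp only [div_eq_mul_inv _ (2 : ℝ)] at *
    linarith

/-- By convexity of `exp` the weight can be put at the larger endpoint. Only decreases seen from
that endpoint then matter, which is why a one-sided gradient suffices later. -/
lemma exp_sub_mul_sub_le (u v : ℝ) :
    (exp u - exp v) * (u - v) ≤ max (u - v) 0 ^ 2 * exp u + max (v - u) 0 ^ 2 * exp v := by
  wlog h : v ≤ u generalizing u v
  · have := this v u (le_of_not_ge h)
    linarith
  rw [max_eq_left (by linarith), max_eq_right (by linarith)]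
  have h1 : exp u - exp v ≤ (u - v) * exp u := by
    have := Real.add_one_le_exp (v - u)
    have h2 : exp v = exp (v - u) * exp u := by rw [← exp_add]; congr 1; ring
    rw [h2]
    nlinarith [exp_pos u]
  nlinarith

lemma cube_entropy_exp_le {n : ℕ} (h : HammingCube n → ℝ) :
    cubeMean (fun x => exp (h x) * h x) -
        cubeMean (fun x => exp (h x)) * log (cubeMean fun x => exp (h x)) ≤
      2⁻¹ * cubeMean fun x => (∑ i, max (h x - h (x.flip i)) 0 ^ 2) * exp (h x) := by
  have H := cube_entropy_le (fun x => exp (h x)) (fun x => exp_pos _)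
  simp only [log_exp] at H
  refine H.trans ?_
  simp only [Finset.sum_mul]
  rw [cubeMean_sum, Finset.mul_sum, Finset.mul_sum]
  refine Finset.sum_le_sum fun i _ => ?_
  have h1 := cubeMean_mono fun x => exp_sub_mul_sub_le (h x) (h (x.flip i))
  -- Flipping exchanges the two one-sided terms, so they have equal means and `4⁻¹` becomes `2⁻¹`.
  have h2 := cubeMean_comp_flip i fun x => max (h x - h (x.flip i)) 0 ^ 2 * exp (h x)
  simp only [HammingCube.flip_flip] at h2
  rw [cubeMean_add, h2] at h1
  linarith

end LogSobolev

/-! ### Herbst's argument and moment bounds -/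

section Concentration

variable {n : ℕ} {g : HammingCube n → ℝ}

lemma cubeMean_entropy_le_of_gradient (hg : ∀ x, ∑ i, max (g x - g (x.flip i)) 0 ^ 2 ≤ 4)
    {t : ℝ} (ht : 0 ≤ t) :
    t * cubeMean (fun x => g x * exp (t * g x)) -
        cubeMean (fun x => exp (t * g x)) * log (cubeMean fun x => exp (t * g x)) ≤
      2 * t ^ 2 * cubeMean fun x => exp (t * g x) := by
  have H := cube_entropy_exp_le (fun x => t * g x)
  rw [← cubeMean_const_mul] at H ⊢
  have h1 : ∀ x, (∑ i, max (t * g x - t * g (x.flip i)) 0 ^ 2) * exp (t * g x) ≤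
      4 * t ^ 2 * exp (t * g x) := by
    intro x
    gcongr
    calc ∑ i, max (t * g x - t * g (x.flip i)) 0 ^ 2
        = t ^ 2 * ∑ i, max (g x - g (x.flip i)) 0 ^ 2 := by
          rw [Finset.mul_sum]
          refine Finset.sum_congr rfl fun i _ => ?_
          rw [← mul_sub, ← mul_pow, mul_max_of_nonneg _ _ ht, mul_zero]
      _ ≤ t ^ 2 * 4 := by gcongr; exact hg x
      _ = 4 * t ^ 2 := mul_comm _ _
  have h2 := cubeMean_mono h1
  rw [cubeMean_const_mul] at h2 ⊢
  have h3 : (fun x => t * (g x * exp (t * g x))) = fun x => exp (t * g x) * (t * g x) := by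
    ext x; ring
  rw [cubeMean_const_mul] at H
  rw [← cubeMean_const_mul, h3]
  linarith

lemma hasDerivAt_cubeMean_exp (g : HammingCube n → ℝ) (t : ℝ) :
    HasDerivAt (fun t => cubeMean fun x => exp (t * g x))
      (cubeMean fun x => g x * exp (t * g x)) t := by
  simp only [cubeMean_real]
  refine HasDerivAt.const_mul _ (HasDerivAt.fun_sum fun x _ => ?_)
  simpa [mul_comm] using ((hasDerivAt_id t).mul_const (g x)).exp

/-- Herbst's argument: a one-sided gradient bound implies a Gaussian exponential moment bound. -/
theorem cubeMean_exp_le_of_gradient (hg : ∀ x, ∑ i, max (g x - g (x.flip i)) 0 ^ 2 ≤ 4)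
    {t : ℝ} (ht : 0 < t) :
    cubeMean (fun x => exp (t * g x)) ≤ exp (t * cubeMean g + 2 * t ^ 2) := by
  set Z : ℝ → ℝ := fun t => cubeMean fun x => exp (t * g x) with hZ
  set Z' : ℝ → ℝ := fun t => cubeMean fun x => g x * exp (t * g x) with hZ'
  have hZpos : ∀ t, 0 < Z t := fun t => cubeMean_pos fun x => exp_pos _
  have hlog : ∀ t, HasDerivAt (fun t => log (Z t)) (Z' t / Z t) t := fun t =>
    (hasDerivAt_cubeMean_exp g t).log (hZpos t).ne'
  have hZ0 : Z 0 = 1 := by simp [hZ, cubeMean_const]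
  have hZ'0 : Z' 0 = cubeMean g := by simp [hZ']
  -- The entropy bound says exactly that `u' ≤ 0`; since `u` tends to the mean of `g` at `0⁺`, it
  -- stays below it.
  set u : ℝ → ℝ := fun t => t⁻¹ * log (Z t) - 2 * t with hu
  have hud : ∀ t, 0 < t → HasDerivAt u (-(t ^ 2)⁻¹ * log (Z t) + t⁻¹ * (Z' t / Z t) - 2) t := by
    intro t ht
    have := ((hasDerivAt_inv ht.ne').mul (hlog t)).sub ((hasDerivAt_id t).const_mul 2)
    exact HasDerivAt.congr_deriv (f := u) this (by simp)
  have hanti : AntitoneOn u (Set.Ioi 0) := by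
    refine antitoneOn_of_deriv_nonpos (convex_Ioi 0)
      (fun t ht => (hud t ht).continuousAt.continuousWithinAt)
      (fun t ht => (hud t (interior_subset ht)).differentiableAt.differentiableWithinAt) ?_
    intro t ht
    have ht : 0 < t := interior_subset ht
    rw [(hud t ht).deriv]
    have h1 : t * Z' t - Z t * log (Z t) ≤ 2 * t ^ 2 * Z t :=
      cubeMean_entropy_le_of_gradient hg ht.le
    have h2 : -(t ^ 2)⁻¹ * log (Z t) + t⁻¹ * (Z' t / Z t) - 2 =
        (t * Z' t - Z t * log (Z t) - 2 * t ^ 2 * Z t) / (t ^ 2 * Z t) := by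
      have := (hZpos t).ne'
      field_simp
      ring
    rw [h2]
    exact div_nonpos_of_nonpos_of_nonneg (by linarith) (mul_nonneg (sq_nonneg _) (hZpos t).le)
  have hlim : Filter.Tendsto u (nhdsWithin 0 (Set.Ioi 0)) (nhds (cubeMean g)) := by
    have h1 := (hlog 0).tendsto_slope_zero_right
    have h2 : Filter.Tendsto (fun t : ℝ => 2 * t) (nhdsWithin 0 (Set.Ioi 0)) (nhds 0) := by
      have : Filter.Tendsto (fun t : ℝ => 2 * t) (nhds 0) (nhds (2 * 0)) :=
        (continuous_const.mul continuous_id).tendsto 0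
      rw [mul_zero] at this
      exact this.mono_left nhdsWithin_le_nhds
    have h3 := h1.sub h2
    simpa [hZ0, hZ'0, hu] using h3
  have hle : u t ≤ cubeMean g := by
    refine ge_of_tendsto hlim ?_
    filter_upwards [Ioc_mem_nhdsGT ht] with s hs
    exact hanti hs.1 ht hs.2
  change Z t ≤ _
  rw [← log_le_iff_le_exp (hZpos t)]
  have h1 : log (Z t) = t * (u t + 2 * t) := by
    simp only [hu]
    field_simp
    ring
  rw [h1]
  nlinarith

lemma rpow_le_mul_exp {y t p : ℝ} (hy : 0 ≤ y) (ht : 0 < t) (hp : 0 < p) :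
    y ^ p ≤ (p / t) ^ p * exp (t * y) := by
  have h1 : y ≤ p / t * exp (t * y / p) := by
    have h2 := Real.add_one_le_exp (t * y / p)
    calc y = p / t * (t * y / p) := by field_simp
      _ ≤ p / t * exp (t * y / p) := by gcongr; linarith
  calc y ^ p ≤ (p / t * exp (t * y / p)) ^ p := by gcongr
    _ = _ := by
      rw [mul_rpow (by positivity) (exp_pos _).le, ← exp_mul]
      congr 2
      field_simp

theorem cubeMean_rpow_le_of_gradient (hg : ∀ x, ∑ i, max (g x - g (x.flip i)) 0 ^ 2 ≤ 4)
    (hg0 : ∀ x, 0 ≤ g x) {M p : ℝ} (hM : cubeMean g ≤ M) (hp : 0 < p) :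
    (cubeMean fun x => g x ^ p) ^ (1 / p) ≤ exp 3 * (M + √p) := by
  have hM0 : 0 ≤ M := (cubeMean_nonneg hg0).trans hM
  have hsp : 0 < √p := sqrt_pos.2 hp
  have hs : √p * √p = p := mul_self_sqrt hp.le
  -- With this `t`, both `t M ≤ p` and `t² ≤ p`, so the exponent `t M + 2 t²` is at most `3 p`.
  set t := p / (M + √p) with ht
  have htpos : 0 < t := by positivity
  have hpt : p / t = M + √p := by rw [ht]; field_simp
  have h1 : t * M ≤ p := by
    rw [ht, div_mul_eq_mul_div, div_le_iff₀ (by positivity)]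
    nlinarith
  have h2 : t ^ 2 ≤ p := by
    have : t ≤ √p := by
      rw [ht, div_le_iff₀ (by positivity)]
      nlinarith
    nlinarith
  have h3 : cubeMean (fun x => g x ^ p) ≤ (exp 3 * (M + √p)) ^ p := by
    calc cubeMean (fun x => g x ^ p) ≤ cubeMean fun x => (p / t) ^ p * exp (t * g x) :=
          cubeMean_mono fun x => rpow_le_mul_exp (hg0 x) htpos hp
      _ ≤ (p / t) ^ p * exp (t * cubeMean g + 2 * t ^ 2) := by
          rw [cubeMean_const_mul]
          gcongr
          exact cubeMean_exp_le_of_gradient hg htpos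
      _ ≤ (p / t) ^ p * exp (3 * p) := by
          gcongr
          nlinarith
      _ = _ := by
          rw [hpt, mul_rpow (exp_pos _).le (by positivity), ← exp_mul, mul_comm]
  rw [one_div]
  exact (rpow_inv_le_iff_of_pos (cubeMean_nonneg fun x => rpow_nonneg (hg0 x) _)
    (by positivity) hp).2 h3

end Concentration

/-! ### Finite product measures -/

section ProductMean

variable {ι α β E : Type*} [Fintype ι] [DecidableEq ι] [Fintype α] [Fintype β]

/-- The mean of `F` under the product, over the index set `ι`, of copies of the law on `α` with
weights `w`. -/
noncomputable def productMean [AddCommMonoid E] [Module ℝ E] (w : α → ℝ) (F : (ι → α) → E) : E :=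
  ∑ c : ι → α, (∏ i, w (c i)) • F c

/-- Change of variables: the image of a product law under a coordinatewise map is the product of the
image laws. -/
lemma productMean_comp [AddCommGroup E] [Module ℝ E] [DecidableEq β] (w : α → ℝ) (X : α → β)
    (F : (ι → β) → E) :
    productMean w (fun c => F (X ∘ c)) =
      productMean (fun b => ∑ a with X a = b, w a) F := by
  classical
  unfold productMean
  rw [← Finset.sum_fiberwise (g := fun c : ι → α => X ∘ c)]
  refine Finset.sum_congr rfl fun b _ => ?_
  rw [Finset.prod_univ_sum, Finset.sum_smul]
  refine Finset.sum_congr ?_ fun c hc => ?_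
  · ext c
    simp [funext_iff]
  · change (∏ i, w (c i)) • F (X ∘ c) = _
    rw [(by simpa [funext_iff] using hc : X ∘ c = b)]

lemma productMean_add [AddCommGroup E] [Module ℝ E] (w : α → ℝ) (F G : (ι → α) → E) :
    productMean w (fun c => F c + G c) = productMean w F + productMean w G := by
  simp only [productMean, smul_add, Finset.sum_add_distrib]

lemma productMean_sum [AddCommGroup E] [Module ℝ E] {κ : Type*} (s : Finset κ) (w : α → ℝ)
    (F : κ → (ι → α) → E) :
    productMean w (fun c => ∑ k ∈ s, F k c) = ∑ k ∈ s, productMean w (F k) := by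
  simp only [productMean, Finset.smul_sum]
  rw [Finset.sum_comm]

lemma productMean_const_smul [AddCommGroup E] [Module ℝ E] (w : α → ℝ) (t : ℝ)
    (F : (ι → α) → E) : productMean w (fun c => t • F c) = t • productMean w F := by
  simp only [productMean, Finset.smul_sum]
  exact Finset.sum_congr rfl fun c _ => smul_comm _ _ _

lemma productMean_const_mul (w : α → ℝ) (t : ℝ) (F : (ι → α) → ℝ) :
    productMean w (fun c => t * F c) = t * productMean w F :=
  productMean_const_smul w t F

lemma productMean_smul_const [AddCommGroup E] [Module ℝ E] (w : α → ℝ) (F : (ι → α) → ℝ)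
    (v : E) : productMean w (fun c => F c • v) = productMean w F • v := by
  simp only [productMean, Finset.sum_smul, smul_eq_mul, mul_smul]

lemma productMean_eval {w : α → ℝ} (hw : ∑ a, w a = 1) (i : ι) (φ : α → ℝ) :
    productMean w (fun c : ι → α => φ (c i)) = ∑ a, w a * φ a := by
  have h1 : ∀ c : ι → α, (∏ j, w (c j)) • φ (c i) =
      ∏ j, w (c j) * (if j = i then φ (c j) else 1) := by
    intro c
    rw [Finset.prod_mul_distrib, Finset.prod_ite_eq' Finset.univ i fun j => φ (c j)]
    simp
  simp only [productMean, h1]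
  have h2 := Finset.prod_univ_sum (fun _ : ι => (Finset.univ : Finset α))
    (fun j a => w a * (if j = i then φ a else 1))
  rw [Fintype.piFinset_univ] at h2
  rw [← h2, Finset.prod_eq_single i]
  · simp
  · intro j _ hj
    simp [hj, hw]
  · simp

lemma productMean_const [AddCommGroup E] [Module ℝ E] {w : α → ℝ} (hw : ∑ a, w a = 1) (v : E) :
    productMean w (fun _ : ι → α => v) = v := by
  have h2 := Finset.prod_univ_sum (fun _ : ι => (Finset.univ : Finset α)) (fun _ a => w a)
  rw [Fintype.piFinset_univ] at h2
  rw [productMean, ← Finset.sum_smul, ← h2]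
  simp [hw]

lemma productMean_mono {w : α → ℝ} (hw : ∀ a, 0 ≤ w a) {F G : (ι → α) → ℝ}
    (h : ∀ c, F c ≤ G c) : productMean w F ≤ productMean w G :=
  Finset.sum_le_sum fun c _ =>
    mul_le_mul_of_nonneg_left (h c) (Finset.prod_nonneg fun i _ => hw (c i))

lemma productMean_nonneg {w : α → ℝ} (hw : ∀ a, 0 ≤ w a) {F : (ι → α) → ℝ}
    (h : ∀ c, 0 ≤ F c) : 0 ≤ productMean w F :=
  Finset.sum_nonneg fun c _ => mul_nonneg (Finset.prod_nonneg fun i _ => hw (c i)) (h c)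

lemma norm_productMean_le [NormedAddCommGroup E] [NormedSpace ℝ E] {w : α → ℝ}
    (hw : ∀ a, 0 ≤ w a) (F : (ι → α) → E) :
    ‖productMean w F‖ ≤ productMean w fun c => ‖F c‖ := by
  refine (norm_sum_le _ _).trans (Finset.sum_le_sum fun c _ => ?_)
  rw [norm_smul, Real.norm_of_nonneg (Finset.prod_nonneg fun i _ => hw (c i)), smul_eq_mul]

lemma productMean_le_sqrt {w : α → ℝ} (hw : ∀ a, 0 ≤ w a) (hw1 : ∑ a, w a = 1)
    (F : (ι → α) → ℝ) : productMean w F ≤ √(productMean w fun c => F c ^ 2) := by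
  refine Real.le_sqrt_of_sq_le ?_
  set m := productMean w F
  have h := productMean_nonneg hw (fun c => sq_nonneg (F c - m))
  have h2 : (fun c => (F c - m) ^ 2) = fun c => F c ^ 2 + ((-2 * m) * F c + m ^ 2) := by
    ext c; ring
  rw [h2, productMean_add, productMean_add, productMean_const_mul, productMean_const hw1] at h
  change 0 ≤ _ + ((-2 * m) * m + m ^ 2) at h
  linarith

lemma productMean_prod [AddCommGroup E] [Module ℝ E] (w : α → ℝ) (w' : β → ℝ)
    (F : (ι → α × β) → E) :
    productMean (fun z : α × β => w z.1 * w' z.2) F =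
      productMean w fun a => productMean w' fun b => F fun i => (a i, b i) := by
  unfold productMean
  rw [← (Equiv.arrowProdEquivProdArrow ι (fun _ => α) (fun _ => β)).symm.sum_comp,
    Fintype.sum_prod_type]
  simp only [Finset.smul_sum, smul_smul, Equiv.arrowProdEquivProdArrow, Equiv.coe_fn_symm_mk,
    Finset.prod_mul_distrib]

lemma cubeMean_eq_productMean {n : ℕ} [AddCommGroup E] [Module ℝ E] (F : HammingCube n → E) :
    cubeMean F = productMean (fun _ : ℤˣ => (2 : ℝ)⁻¹) F := by
  simp [cubeMean, productMean, Finset.smul_sum]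

lemma cubeMean_productMean_comm {n : ℕ} (w : α → ℝ) (F : HammingCube n → (ι → α) → ℝ) :
    (cubeMean fun s => productMean w (F s)) = productMean w fun c => cubeMean fun s => F s c := by
  simp only [cubeMean, productMean, Finset.smul_sum]
  rw [Finset.sum_comm]
  exact Finset.sum_congr rfl fun c _ => Finset.sum_congr rfl fun s _ => smul_comm _ _ _

end ProductMean

/-! ### Cotype and sparse or biased random sums -/

section Cotype

variable {E : Type*} [NormedAddCommGroup E] [NormedSpace ℝ E] {Q K : ℝ}

lemma intUnits_smul_eq (a : ℤˣ) (v : E) : a • v = ((a : ℤ) : ℝ) • v := by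
  rw [Units.smul_def, Int.cast_smul_eq_zsmul]

/-- Hölder from ℓ^Q to ℓ², which costs the power of `m`. -/
lemma HasCotypeWith.sum_sq_le (h : HasCotypeWith E Q K) {m : ℕ} (v : Fin m → E) :
    ∑ i, ‖v i‖ ^ 2 ≤ (m : ℝ) ^ (1 - 2 / Q) * (K ^ 2 *
      cubeMean fun ε : HammingCube m => ‖∑ i, ε i • v i‖ ^ 2) := by
  obtain ⟨hQ, hK, hv⟩ := h
  have hQ0 : 0 < Q := by linarith
  set R := cubeMean fun ε : HammingCube m => ‖∑ i, ε i • v i‖ ^ 2 with hR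
  have hR0 : 0 ≤ R := cubeMean_nonneg fun _ => sq_nonneg _
  have hS0 : 0 ≤ ∑ i, ‖v i‖ ^ Q := Finset.sum_nonneg fun i _ => by positivity
  have h1 := Real.rpow_sum_le_const_mul_sum_rpow Finset.univ (fun i => ‖v i‖ ^ 2)
    (p := Q / 2) (by linarith)
  have h2 : ∀ i, (‖v i‖ ^ 2) ^ (Q / 2) = ‖v i‖ ^ Q := by
    intro i
    rw [← rpow_natCast_mul (norm_nonneg _)]
    congr 1
    push_cast
    ring
  have h3 : ∀ i, |‖v i‖ ^ 2| = ‖v i‖ ^ 2 := fun i => abs_of_nonneg (by positivity)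
  simp only [h2, h3, Finset.card_univ, Fintype.card_fin] at h1
  have h4 : (∑ i, ‖v i‖ ^ 2) ≤ ((m : ℝ) ^ (Q / 2 - 1) * ∑ i, ‖v i‖ ^ Q) ^ (Q / 2)⁻¹ :=
    (le_rpow_inv_iff_of_pos (Finset.sum_nonneg fun i _ => by positivity) (by positivity)
      (by positivity)).2 h1
  refine h4.trans ?_
  rw [mul_rpow (by positivity) hS0, ← rpow_mul (by positivity)]
  have h5 : (Q / 2 - 1) * (Q / 2)⁻¹ = 1 - 2 / Q := by field_simp
  rw [h5]
  gcongr
  have h6 : (∑ i, ‖v i‖ ^ Q) ^ (Q / 2)⁻¹ = ((∑ i, ‖v i‖ ^ Q) ^ (1 / Q)) ^ 2 := by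
    rw [← rpow_mul_natCast hS0]
    congr 1
    push_cast
    field_simp
  rw [h6]
  calc ((∑ i, ‖v i‖ ^ Q) ^ (1 / Q)) ^ 2 ≤ (K * √R) ^ 2 := by
        gcongr
        exact hv m v
    _ = K ^ 2 * R := by rw [mul_pow, sq_sqrt hR0]

/-- The law of a random sign multiplied by an independent Bernoulli selector of mean `τ`. -/
noncomputable def selectorLaw (τ : ℝ) (s : SignType) : ℝ := if s = 0 then 1 - τ else τ / 2

lemma sum_selectorLaw (τ : ℝ) : ∑ s, selectorLaw τ s = 1 := by
  rw [show (Finset.univ : Finset SignType) = {0, -1, 1} from rfl]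
  simp [selectorLaw]

lemma selectorLaw_nonneg {τ : ℝ} (h0 : 0 ≤ τ) (h1 : τ ≤ 1) (s : SignType) :
    0 ≤ selectorLaw τ s := by
  unfold selectorLaw
  split_ifs <;> linarith

/-- An integer unit seen as a sign. -/
def unitSign (a : ℤˣ) : SignType := if a = 1 then 1 else -1

lemma unitSign_cast (a : ℤˣ) : ((unitSign a : SignType) : ℝ) = ((a : ℤ) : ℝ) := by
  rcases Int.units_eq_one_or a with rfl | rfl <;> simp [unitSign]

lemma sum_fiber_selector {κ : Type*} [Fintype κ] [DecidableEq κ] {w : κ → ℝ}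
    (hw : ∑ k, w k = 1) (k : κ) (s : SignType) :
    ∑ a : κ × ℤˣ with (if a.1 = k then unitSign a.2 else 0) = s, w a.1 * 2⁻¹ =
      selectorLaw (w k) s := by
  rw [Finset.sum_filter, Fintype.sum_prod_type]
  simp only [sum_intUnits]
  have key : ∀ x, ((if (if x = k then unitSign 1 else 0) = s then w x * 2⁻¹ else 0) +
      if (if x = k then unitSign (-1) else 0) = s then w x * 2⁻¹ else 0) =
      (if s = 0 then w x else 0) + if x = k then
        (if s = 0 then - w x else w x / 2) else 0 := by
    intro x
    rcases s <;> by_cases hx : x = k <;> simp [hx, unitSign] <;> ring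
  simp only [key, Finset.sum_add_distrib, Finset.sum_ite_eq', Finset.mem_univ, if_true]
  unfold selectorLaw
  split_ifs
  · rw [hw]; ring
  · simp

/-- A uniform sign stays uniform after multiplication by a sign that depends only on the independent
colour. -/
lemma sum_fiber_unit_mul {κ : Type*} [Fintype κ] {w : κ → ℝ} (hw : ∑ k, w k = 1) (s : κ → ℤˣ)
    (b : ℤˣ) : ∑ a : κ × ℤˣ with s a.1 * a.2 = b, w a.1 * 2⁻¹ = 2⁻¹ := by
  rw [Finset.sum_filter, Fintype.sum_prod_type]
  have key : ∀ x, ∑ y : ℤˣ, (if s x * y = b then w x * (2 : ℝ)⁻¹ else 0) = w x * 2⁻¹ := by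
    intro x
    rw [Finset.sum_eq_single ((s x)⁻¹ * b)]
    · rw [mul_inv_cancel_left, if_pos rfl]
    · intro y _ hy
      rw [if_neg]
      rintro rfl
      exact hy (inv_mul_cancel_left _ _).symm
    · exact fun h => absurd (Finset.mem_univ _) h
  simp only [key]
  rw [← Finset.sum_mul, hw, one_mul]

/-- Selecting the summands of a Rademacher sum with probability `τ` gains a factor `τ ^ (1 / Q)`
in a space of cotype `Q`. -/
theorem HasCotypeWith.productMean_selector_le (h : HasCotypeWith E Q K) {n : ℕ} (v : Fin n → E)
    {τ : ℝ} (h0 : 0 < τ) (h1 : τ ≤ 1) :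
    productMean (selectorLaw τ)
        (fun x : Fin n → SignType => ‖∑ i, ((x i : SignType) : ℝ) • v i‖ ^ 2) ≤
      2 * τ ^ (2 / Q) * (K ^ 2 * cubeMean fun ε : HammingCube n => ‖∑ i, ε i • v i‖ ^ 2) := by
  classical
  have hQ : 2 ≤ Q := h.1
  set R := cubeMean fun ε : HammingCube n => ‖∑ i, ε i • v i‖ ^ 2 with hR
  have hR0 : 0 ≤ R := cubeMean_nonneg fun _ => sq_nonneg _
  set A := productMean (selectorLaw τ)
    (fun x : Fin n → SignType => ‖∑ i, ((x i : SignType) : ℝ) • v i‖ ^ 2) with hA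
  -- Each index gets a random colour, with `N` colours of probability `τ` and one leftover colour,
  -- and a random sign. Each ordinary colour class is a copy of the sparse sum, while the signed sum
  -- of all classes is the full Rademacher sum.
  set N := ⌊1 / τ⌋₊ with hN
  have hN1 : 1 ≤ N := Nat.le_floor (by rw [le_div_iff₀ h0]; simpa using h1)
  have hN1' : (1 : ℝ) ≤ N := by exact_mod_cast hN1
  have hNτ : N * τ ≤ 1 := by
    have := Nat.floor_le (a := 1 / τ) (by positivity)
    rwa [le_div_iff₀ h0] at this
  have hNτ' : 1 ≤ (N + 1) * τ := by
    have := (Nat.lt_floor_add_one (1 / τ)).le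
    rwa [div_le_iff₀ h0] at this
  set w : Fin (N + 1) → ℝ := fun k => if k = Fin.last N then 1 - N * τ else τ with hw
  have hw0 : ∀ k, 0 ≤ w k := by
    intro k
    simp only [hw]
    split_ifs <;> linarith
  have hwc : ∀ j : Fin N, w j.castSucc = τ := by
    intro j
    simp [hw, Fin.castSucc_ne_last]
  have hw1 : ∑ k, w k = 1 := by
    rw [Fin.sum_univ_castSucc]
    simp only [hwc]
    simp [hw]
  set W : Fin (N + 1) × ℤˣ → ℝ := fun a => w a.1 * 2⁻¹ with hW
  have hW0 : ∀ a, 0 ≤ W a := fun a => mul_nonneg (hw0 _) (by norm_num)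
  let X : Fin (N + 1) → Fin (N + 1) × ℤˣ → SignType :=
    fun k a => if a.1 = k then unitSign a.2 else 0
  let S : (Fin n → Fin (N + 1) × ℤˣ) → Fin (N + 1) → E :=
    fun c k => ∑ i, ((X k (c i) : SignType) : ℝ) • v i
  have hS : ∀ c (s : HammingCube (N + 1)),
      ∑ k, s k • S c k = ∑ i, (s (c i).1 * (c i).2) • v i := by
    intro c s
    simp only [S, Finset.smul_sum]
    rw [Finset.sum_comm]
    refine Finset.sum_congr rfl fun i _ => ?_
    rw [Finset.sum_eq_single (c i).1]
    · simp only [X, if_true, unitSign_cast, ← intUnits_smul_eq, mul_smul]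
    · intro k _ hk
      simp [X, hk.symm]
    · exact fun h => absurd (Finset.mem_univ _) h
  have hcot := productMean_mono hW0 fun c => h.sum_sq_le (S c)
  rw [productMean_const_mul, productMean_const_mul, ← cubeMean_productMean_comm,
    productMean_sum] at hcot
  have hright : ∀ s : HammingCube (N + 1),
      productMean W (fun c => ‖∑ k, s k • S c k‖ ^ 2) = R := by
    intro s
    simp only [hS]
    rw [hR, cubeMean_eq_productMean]
    have := productMean_comp (ι := Fin n) W (fun a => s a.1 * a.2)
      (fun ε : Fin n → ℤˣ => ‖∑ i, ε i • v i‖ ^ 2)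
    simp only [W, sum_fiber_unit_mul hw1 s] at this
    exact this
  have hleft : ∀ k, productMean W (fun c => ‖S c k‖ ^ 2) = productMean (selectorLaw (w k))
      (fun x : Fin n → SignType => ‖∑ i, ((x i : SignType) : ℝ) • v i‖ ^ 2) := by
    intro k
    have := productMean_comp (ι := Fin n) W (X k)
      (fun x : Fin n → SignType => ‖∑ i, ((x i : SignType) : ℝ) • v i‖ ^ 2)
    simp only [W, X, sum_fiber_selector hw1 k] at this
    exact this
  simp only [hright, cubeMean_const] at hcot
  rw [Fin.sum_univ_castSucc] at hcot
  have hlast : 0 ≤ productMean W (fun c => ‖S c (Fin.last N)‖ ^ 2) :=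
    productMean_nonneg hW0 fun _ => sq_nonneg _
  simp only [hleft, hwc, Finset.sum_const, Finset.card_univ, Fintype.card_fin, nsmul_eq_mul,
    ← hA] at hcot hlast
  push_cast at hcot
  have hKR : 0 ≤ K ^ 2 * R := by positivity
  -- Uses `N + 1 ≤ 2 N` and `(N + 1) τ ≥ 1`.
  have hpow : ((N : ℝ) + 1) ^ (1 - 2 / Q) ≤ N * (2 * τ ^ (2 / Q)) := by
    have hNp : (0 : ℝ) < N + 1 := by positivity
    rw [rpow_sub hNp, rpow_one, div_le_iff₀ (by positivity)]
    have h2 : (1 : ℝ) ≤ (((N : ℝ) + 1) * τ) ^ (2 / Q) := one_le_rpow hNτ' (by positivity)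
    rw [mul_rpow hNp.le h0.le] at h2
    nlinarith
  have hfin : (N : ℝ) * A ≤ N * (2 * τ ^ (2 / Q) * (K ^ 2 * R)) := by
    have := mul_le_mul_of_nonneg_right hpow hKR
    linarith
  exact le_of_mul_le_mul_left hfin (by linarith)

/-- The law of a sign of mean `r`. -/
noncomputable def biasedLaw (r : ℝ) (a : ℤˣ) : ℝ := (1 + r * ((a : ℤ) : ℝ)) / 2

lemma sum_biasedLaw (r : ℝ) : ∑ a, biasedLaw r a = 1 := by
  rw [sum_intUnits]
  simp only [biasedLaw]
  push_cast
  ring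

lemma biasedLaw_nonneg {r : ℝ} (h0 : 0 ≤ r) (h1 : r ≤ 1) (a : ℤˣ) : 0 ≤ biasedLaw r a := by
  rcases Int.units_eq_one_or a with rfl | rfl <;> simp [biasedLaw] <;> linarith

/-- Half the difference of two signs. -/
def halfDiff (z : ℤˣ × ℤˣ) : SignType := if z.1 = z.2 then 0 else unitSign z.1

lemma two_mul_halfDiff_cast (z : ℤˣ × ℤˣ) :
    2 * ((halfDiff z : SignType) : ℝ) = ((z.1 : ℤ) : ℝ) - ((z.2 : ℤ) : ℝ) := by
  obtain ⟨a, b⟩ := z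
  rcases Int.units_eq_one_or a with rfl | rfl <;> rcases Int.units_eq_one_or b with rfl | rfl <;>
    simp [halfDiff, unitSign] <;> norm_num

lemma sum_fiber_halfDiff (r : ℝ) (s : SignType) :
    ∑ z : ℤˣ × ℤˣ with halfDiff z = s, biasedLaw r z.1 * biasedLaw r z.2 =
      selectorLaw ((1 - r ^ 2) / 2) s := by
  rw [Finset.sum_filter, Fintype.sum_prod_type]
  simp only [sum_intUnits]
  rcases s <;> simp [halfDiff, unitSign, biasedLaw, selectorLaw] <;> ring

theorem HasCotypeWith.productMean_biased_le (h : HasCotypeWith E Q K) {n : ℕ} (v : Fin n → E)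
    {r : ℝ} (h0 : 0 ≤ r) (h1 : r < 1)
    (hv : (cubeMean fun ε : HammingCube n => ‖∑ i, ε i • v i‖ ^ 2) ≤ 1) :
    productMean (biasedLaw r) (fun ξ : Fin n → ℤˣ => ‖∑ i, (((ξ i : ℤ) : ℝ) - r) • v i‖) ≤
      2 * (√2 * K * ((1 - r ^ 2) / 2) ^ (1 / Q)) := by
  have hK : 0 ≤ K := h.2.1
  have hb0 := biasedLaw_nonneg h0 h1.le
  have hb1 := sum_biasedLaw r
  set τ := (1 - r ^ 2) / 2 with hτ
  have hτ0 : 0 < τ := by rw [hτ]; nlinarith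
  have hτ1 : τ ≤ 1 := by rw [hτ]; nlinarith
  have hmean : ∀ i : Fin n,
      productMean (biasedLaw r) (fun ξ : Fin n → ℤˣ => ((ξ i : ℤ) : ℝ)) = r := by
    intro i
    rw [productMean_eval hb1 i fun a : ℤˣ => ((a : ℤ) : ℝ), sum_intUnits]
    simp only [biasedLaw]
    push_cast
    ring
  -- Symmetrization: `r` is the mean of an independent copy `ζ`. Two such signs differ with
  -- probability `(1 - r²) / 2`, and given that they differ, the half-difference is a uniform sign.
  have hjensen : ∀ ξ : Fin n → ℤˣ, ‖∑ i, (((ξ i : ℤ) : ℝ) - r) • v i‖ ≤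
      productMean (biasedLaw r) fun ζ : Fin n → ℤˣ =>
        ‖∑ i, (((ξ i : ℤ) : ℝ) - ((ζ i : ℤ) : ℝ)) • v i‖ := by
    intro ξ
    refine le_of_eq_of_le ?_ (norm_productMean_le hb0 _)
    congr 1
    rw [productMean_sum]
    refine Finset.sum_congr rfl fun i _ => ?_
    have h2 : (fun ζ : Fin n → ℤˣ => ((ξ i : ℤ) : ℝ) - ((ζ i : ℤ) : ℝ)) =
        fun ζ : Fin n → ℤˣ => ((ξ i : ℤ) : ℝ) + (-1) * ((ζ i : ℤ) : ℝ) := by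
      ext ζ; ring
    rw [productMean_smul_const, h2, productMean_add, productMean_const_mul, hmean,
      productMean_const hb1]
    congr 1
    ring
  refine (productMean_mono hb0 hjensen).trans ?_
  rw [← productMean_prod (biasedLaw r) (biasedLaw r) fun z : Fin n → ℤˣ × ℤˣ =>
    ‖∑ i, ((((z i).1 : ℤ) : ℝ) - (((z i).2 : ℤ) : ℝ)) • v i‖]
  simp only [← two_mul_halfDiff_cast, mul_smul, ← Finset.smul_sum, norm_smul, Real.norm_ofNat]
  rw [productMean_const_mul]
  have h3 := productMean_comp (ι := Fin n) (fun z : ℤˣ × ℤˣ => biasedLaw r z.1 * biasedLaw r z.2)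
    halfDiff (fun x : Fin n → SignType => ‖∑ i, ((x i : SignType) : ℝ) • v i‖)
  simp only [sum_fiber_halfDiff] at h3
  have h4 := (productMean_le_sqrt (selectorLaw_nonneg hτ0.le hτ1) (sum_selectorLaw τ)
    (fun x : Fin n → SignType => ‖∑ i, ((x i : SignType) : ℝ) • v i‖)).trans
    (sqrt_le_sqrt (h.productMean_selector_le v hτ0 hτ1))
  refine mul_le_mul_of_nonneg_left ((h3.le.trans h4).trans ?_) zero_le_two
  refine sqrt_le_iff.2 ⟨by positivity, ?_⟩
  rw [mul_pow, mul_pow, sq_sqrt zero_le_two, ← rpow_mul_natCast hτ0.le]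
  have h5 : 1 / Q * ((2 : ℕ) : ℝ) = 2 / Q := by push_cast; ring
  rw [h5]
  have h6 : K ^ 2 * (cubeMean fun ε : HammingCube n => ‖∑ i, ε i • v i‖ ^ 2) ≤ K ^ 2 * 1 := by
    gcongr
  have h7 : 0 ≤ 2 * τ ^ (2 / Q) := by positivity
  nlinarith

end Cotype

/-! ### Orthogonality of the coordinate signs -/

section Orthogonality

lemma cubeMean_sq_sum {n : ℕ} (a : Fin n → ℝ) :
    cubeMean (fun δ : HammingCube n => (∑ i, ((δ i : ℤ) : ℝ) * a i) ^ 2) = ∑ i, a i ^ 2 := by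
  induction n with
  | zero => simp [cubeMean_real]
  | succ n ih =>
    rw [cubeMean_succ, ← cubeMean_add, Fin.sum_univ_succ, ← ih fun i => a i.succ]
    simp only [Fin.sum_univ_succ, Fin.cons_zero, Fin.cons_succ]
    have : ∀ y : HammingCube n,
        ((((1 : ℤˣ) : ℤ) : ℝ) * a 0 + ∑ i : Fin n, ((y i : ℤ) : ℝ) * a i.succ) ^ 2 +
        ((((-1 : ℤˣ) : ℤ) : ℝ) * a 0 + ∑ i : Fin n, ((y i : ℤ) : ℝ) * a i.succ) ^ 2 =
        2 * (∑ i : Fin n, ((y i : ℤ) : ℝ) * a i.succ) ^ 2 + 2 * a 0 ^ 2 := by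
      intro y
      push_cast
      ring
    simp only [this]
    rw [cubeMean_add, cubeMean_const_mul, cubeMean_const]
    ring

end Orthogonality

/-! ### One-sided gradient of the distance to a point -/

section Lipschitz

variable {E : Type*} [NormedAddCommGroup E] [NormedSpace ℝ E] {n : ℕ} {f : HammingCube n → E}

/-- A Lipschitz function has distances to a fixed point with a bounded one-sided gradient. -/
lemma IsCubeLipschitz.sum_sq_norm_sub_le (hf : IsCubeLipschitz f) (m : E) (x : HammingCube n) :
    ∑ i, max (‖f x - m‖ - ‖f (x.flip i) - m‖) 0 ^ 2 ≤ 4 := by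
  -- One functional, norming at `x`, serves all `i`. At the neighbours it only bounds the norm from
  -- below, hence the positive part.
  obtain ⟨φ, hφ, hφx⟩ := exists_dual_vector'' ℝ (f x - m)
  have hle : ∀ v : E, |φ v| ≤ ‖v‖ := fun v => by
    simpa using φ.le_of_opNorm_le hφ v
  have h1 : ∀ i, max (‖f x - m‖ - ‖f (x.flip i) - m‖) 0 ^ 2 ≤ 4 * φ (cubeDeriv i f x) ^ 2 := by
    intro i
    have h2 : ‖f x - m‖ - ‖f (x.flip i) - m‖ ≤ 2 * φ (cubeDeriv i f x) := by
      have h3 := (abs_le.1 (hle (f (x.flip i) - m))).2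
      have h4 : 2 * φ (cubeDeriv i f x) = φ (f x - m) - φ (f (x.flip i) - m) := by
        simp only [cubeDeriv, HammingCube.flip, map_smul, map_sub, smul_eq_mul]
        ring
      rw [h4, hφx]
      change ‖f x - m‖ - _ ≤ ‖f x - m‖ - _
      linarith
    have h5 : max (‖f x - m‖ - ‖f (x.flip i) - m‖) 0 ≤ |2 * φ (cubeDeriv i f x)| :=
      max_le (h2.trans (le_abs_self _)) (abs_nonneg _)
    calc max (‖f x - m‖ - ‖f (x.flip i) - m‖) 0 ^ 2 ≤ |2 * φ (cubeDeriv i f x)| ^ 2 := by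
          gcongr
      _ = 4 * φ (cubeDeriv i f x) ^ 2 := by rw [sq_abs]; ring
  calc ∑ i, max (‖f x - m‖ - ‖f (x.flip i) - m‖) 0 ^ 2
      ≤ 4 * ∑ i, φ (cubeDeriv i f x) ^ 2 := by
        rw [Finset.mul_sum]
        exact Finset.sum_le_sum fun i _ => h1 i
    _ = 4 * cubeMean fun δ : HammingCube n => φ (∑ i, δ i • cubeDeriv i f x) ^ 2 := by
        rw [← cubeMean_sq_sum]
        simp only [intUnits_smul_eq, map_sum, map_smul, smul_eq_mul]
    _ ≤ 4 * 1 := by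
        gcongr
        refine (cubeMean_mono fun δ => ?_).trans (hf x)
        rw [← sq_abs]
        gcongr
        exact hle _
    _ = 4 := mul_one _

end Lipschitz

/-! ### Interpolation by biased noise and the first moment -/

section Noise

variable {n : ℕ}

lemma productMean_biasedLaw_one (Φ : HammingCube n → ℝ) :
    productMean (biasedLaw 1) Φ = Φ 1 := by
  rw [productMean, Finset.sum_eq_single 1]
  · simp [biasedLaw]
  · intro ξ _ hξ
    obtain ⟨i, hi⟩ := Function.ne_iff.1 hξ
    have hi : ξ i = -1 := (Int.units_eq_one_or _).resolve_left hi
    rw [Finset.prod_eq_zero (Finset.mem_univ i) (by simp [biasedLaw, hi]), zero_smul]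
  · exact fun h => absurd (Finset.mem_univ _) h

lemma productMean_biasedLaw_zero (Φ : HammingCube n → ℝ) :
    productMean (biasedLaw 0) Φ = cubeMean Φ := by
  rw [cubeMean_eq_productMean]
  congr 1
  ext a
  simp [biasedLaw]

/-- The derivative in the bias of an expectation of biased signs. -/
lemma hasDerivAt_productMean_biasedLaw (Φ : HammingCube n → ℝ) {r : ℝ} (hr : 1 - r ^ 2 ≠ 0) :
    HasDerivAt (fun r => productMean (biasedLaw r) Φ)
      ((1 - r ^ 2)⁻¹ * productMean (biasedLaw r) fun ξ : Fin n → ℤˣ =>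
        ∑ i, (((ξ i : ℤ) : ℝ) - r) * cubeDeriv i Φ ξ) r := by
  have hb : ∀ a : ℤˣ, HasDerivAt (fun r => biasedLaw r a) (((a : ℤ) : ℝ) / 2) r := by
    intro a
    simpa [biasedLaw] using
      (((hasDerivAt_id r).mul_const ((a : ℤ) : ℝ)).const_add 1).div_const 2
  have h1 := HasDerivAt.fun_sum (u := Finset.univ) fun (ξ : HammingCube n) _ =>
    (HasDerivAt.fun_finsetProd (u := Finset.univ)
      fun (i : Fin n) _ => hb (ξ i)).smul_const (Φ ξ)
  refine HasDerivAt.congr_deriv (f := fun r => productMean (biasedLaw r) Φ) h1 ?_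
  have hflip : ∀ (i : Fin n) (H : HammingCube n → ℝ),
      ∑ ξ : HammingCube n, H (ξ.flip i) = ∑ ξ, H ξ := by
    intro i H
    have := cubeMean_comp_flip i H
    rw [cubeMean_real, cubeMean_real] at this
    exact mul_left_cancel₀ (by positivity) this
  simp only [Finset.sum_smul]
  rw [productMean_sum, Finset.mul_sum, Finset.sum_comm]
  refine Finset.sum_congr rfl fun i _ => ?_
  set P : HammingCube n → ℝ := fun ξ => ∏ j ∈ Finset.univ.erase i, biasedLaw r (ξ j) with hP
  have hPf : ∀ ξ : HammingCube n, P (ξ.flip i) = P ξ := by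
    intro ξ
    refine Finset.prod_congr rfl fun j hj => ?_
    rw [HammingCube.flip, Function.update_of_ne (Finset.ne_of_mem_erase hj)]
  -- Summation by parts: the flip changes the sign of `ξ i` and fixes `P`, turning `Φ` into half the
  -- difference of `Φ` and its flip.
  have h2 : ∑ ξ : HammingCube n, P ξ * ((ξ i : ℤ) : ℝ) * Φ (ξ.flip i) =
      - ∑ ξ : HammingCube n, P ξ * ((ξ i : ℤ) : ℝ) * Φ ξ := by
    rw [← hflip i fun ξ => P ξ * ((ξ i : ℤ) : ℝ) * Φ ξ, ← Finset.sum_neg_distrib]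
    refine Finset.sum_congr rfl fun ξ _ => ?_
    rw [hPf]
    simp [HammingCube.flip]
  have h3 : (1 - r ^ 2)⁻¹ * productMean (biasedLaw r) (fun ξ : HammingCube n =>
      (((ξ i : ℤ) : ℝ) - r) * cubeDeriv i Φ ξ) =
      ∑ ξ : HammingCube n,
        (P ξ * ((ξ i : ℤ) : ℝ) * Φ ξ - P ξ * ((ξ i : ℤ) : ℝ) * Φ (ξ.flip i)) / 4 := by
    rw [productMean, Finset.mul_sum]
    refine Finset.sum_congr rfl fun ξ _ => ?_
    rw [← Finset.mul_prod_erase _ _ (Finset.mem_univ i)]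
    change (1 - r ^ 2)⁻¹ * ((biasedLaw r (ξ i) * P ξ) *
      ((((ξ i : ℤ) : ℝ) - r) * (2⁻¹ * (Φ ξ - Φ (HammingCube.flip i ξ))))) = _
    have h4 : biasedLaw r (ξ i) * (((ξ i : ℤ) : ℝ) - r) = (1 - r ^ 2) * ((ξ i : ℤ) : ℝ) / 2 := by
      rcases Int.units_eq_one_or (ξ i) with h | h <;> simp [h, biasedLaw] <;> ring
    calc _ = (1 - r ^ 2)⁻¹ * (biasedLaw r (ξ i) * (((ξ i : ℤ) : ℝ) - r)) *
          (P ξ * (2⁻¹ * (Φ ξ - Φ (HammingCube.flip i ξ)))) := by ring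
      _ = _ := by
        rw [h4]
        field_simp
        ring
  rw [h3, ← Finset.sum_div, Finset.sum_sub_distrib, h2, sub_neg_eq_add, ← two_mul,
    Finset.mul_sum, Finset.sum_div]
  refine Finset.sum_congr rfl fun ξ _ => ?_
  simp only [smul_eq_mul, hP]
  ring

variable {E : Type*} [NormedAddCommGroup E] [NormedSpace ℝ E] {f : HammingCube n → E} {Q K : ℝ}

/-- The first central moment of a Lipschitz function with values in a space of cotype `Q`. -/
theorem IsCubeLipschitz.cubeMean_norm_sub_le (hf : IsCubeLipschitz f) (hE : HasCotypeWith E Q K) :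
    cubeMean (fun x => ‖f x - cubeMean f‖) ≤ 2 * √2 * (K * Q) := by
  have hQ : 2 ≤ Q := hE.1
  have hK : 0 ≤ K := hE.2.1
  choose φ hφ hφx using fun x => exists_dual_vector'' ℝ (f x - cubeMean f)
  have hle : ∀ x (v : E), φ x v ≤ ‖v‖ := fun x v =>
    (le_abs_self _).trans (by simpa using (φ x).le_of_opNorm_le (hφ x) v)
  -- The functional is tied to `x`, not to the noise `ξ`, so `G 1 - G 0` is exactly the first
  -- central moment.
  set G : ℝ → ℝ := fun r => cubeMean fun x : HammingCube n =>
    productMean (biasedLaw r) fun ξ : HammingCube n => φ x (f (ξ * x)) with hG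
  set G' : ℝ → ℝ := fun r => cubeMean fun x : HammingCube n =>
    (1 - r ^ 2)⁻¹ * productMean (biasedLaw r) fun ξ : HammingCube n =>
      ∑ i, (((ξ i : ℤ) : ℝ) - r) * cubeDeriv i (fun ξ : HammingCube n => φ x (f (ξ * x))) ξ with hG'
  have hGd : ∀ r, 1 - r ^ 2 ≠ 0 → HasDerivAt G (G' r) r := fun r hr =>
    HasDerivAt.const_mul _ (HasDerivAt.fun_sum fun x _ => hasDerivAt_productMean_biasedLaw _ hr)
  have hGc : Continuous G := by
    simp only [hG, cubeMean_real, productMean, biasedLaw]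
    fun_prop
  have hG'le : ∀ r, 0 ≤ r → r < 1 → G' r ≤ 2 * √2 * K * (1 - r) ^ (1 / Q - 1) := by
    intro r h0 h1
    have hb0 := biasedLaw_nonneg h0 h1.le
    have hr : 0 < 1 - r ^ 2 := by nlinarith
    have h2 : ∀ x ξ : HammingCube n,
        ∑ i, (((ξ i : ℤ) : ℝ) - r) * cubeDeriv i (fun ξ : HammingCube n => φ x (f (ξ * x))) ξ ≤
          ‖∑ i, (((ξ i : ℤ) : ℝ) - r) • cubeDeriv i f (ξ * x)‖ := by
      intro x ξ
      refine le_of_eq_of_le ?_ (hle x _)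
      rw [map_sum]
      refine Finset.sum_congr rfl fun i _ => ?_
      have h3 : Function.update ξ i (-ξ i) * x = Function.update (ξ * x) i (-(ξ * x) i) := by
        ext j
        by_cases h : j = i
        · subst h; simp
        · simp [h]
      simp only [cubeDeriv, map_smul, map_sub, h3]
      rfl
    -- Once the functionals are gone, `y = ξ * x` is uniform for each fixed `ξ`, so point and noise
    -- decouple and the Lipschitz condition applies at `y`.
    have h4 : (cubeMean fun x : HammingCube n => productMean (biasedLaw r)
        fun ξ : HammingCube n => ‖∑ i, (((ξ i : ℤ) : ℝ) - r) • cubeDeriv i f (ξ * x)‖) =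
        cubeMean fun y : HammingCube n => productMean (biasedLaw r)
        fun ξ : HammingCube n => ‖∑ i, (((ξ i : ℤ) : ℝ) - r) • cubeDeriv i f y‖ := by
      rw [cubeMean_productMean_comm, cubeMean_productMean_comm]
      congr 1
      ext ξ
      exact cubeMean_comp_equiv (Equiv.mulLeft ξ)
        fun y => ‖∑ i, (((ξ i : ℤ) : ℝ) - r) • cubeDeriv i f y‖
    calc G' r = (1 - r ^ 2)⁻¹ * cubeMean fun x : HammingCube n =>
          productMean (biasedLaw r) fun ξ : HammingCube n => ∑ i, (((ξ i : ℤ) : ℝ) - r) *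
            cubeDeriv i (fun ξ : HammingCube n => φ x (f (ξ * x))) ξ := cubeMean_const_mul _ _
      _ ≤ (1 - r ^ 2)⁻¹ * cubeMean fun x : HammingCube n => productMean (biasedLaw r)
          fun ξ : HammingCube n => ‖∑ i, (((ξ i : ℤ) : ℝ) - r) • cubeDeriv i f (ξ * x)‖ := by
          gcongr
          exact cubeMean_mono fun x => productMean_mono hb0 (h2 x)
      _ ≤ (1 - r ^ 2)⁻¹ * (2 * (√2 * K * ((1 - r ^ 2) / 2) ^ (1 / Q))) := by
          rw [h4]
          gcongr
          refine (cubeMean_mono fun y => ?_).trans_eq (cubeMean_const _)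
          exact hE.productMean_biased_le _ h0 h1 (hf y)
      _ ≤ (1 - r ^ 2)⁻¹ * (2 * (√2 * K * (1 - r ^ 2) ^ (1 / Q))) := by
          gcongr
          linarith
      _ = 2 * √2 * K * (1 - r ^ 2) ^ (1 / Q - 1) := by
          rw [rpow_sub hr, rpow_one]
          ring
      _ ≤ 2 * √2 * K * (1 - r) ^ (1 / Q - 1) := by
          refine mul_le_mul_of_nonneg_left ?_ (by positivity)
          refine rpow_le_rpow_of_nonpos (by linarith) (by nlinarith) ?_
          rw [sub_nonpos, div_le_one (by linarith)]
          linarith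
  -- A primitive of the bound on `G'`, continuous up to `r = 1`. Monotonicity of `B - G` replaces
  -- integration of the singular bound.
  set B : ℝ → ℝ := fun r => -(2 * √2 * K * Q) * (1 - r) ^ (1 / Q) with hB
  have hBd : ∀ r, r < 1 → HasDerivAt B (2 * √2 * K * (1 - r) ^ (1 / Q - 1)) r := by
    intro r hr
    have := (((hasDerivAt_id r).const_sub 1).rpow_const (p := 1 / Q)
      (Or.inl (sub_pos.2 hr).ne')).const_mul (-(2 * √2 * K * Q))
    refine HasDerivAt.congr_deriv (f := B) this ?_
    simp only [id]
    field_simp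
  have hBc : Continuous B := by
    have : 0 ≤ 1 / Q := by positivity
    exact continuous_const.mul ((continuous_const.sub continuous_id).rpow_const
      fun _ => Or.inr this)
  have hd : ∀ r ∈ interior (Set.Icc (0 : ℝ) 1),
      HasDerivAt (fun r => B r - G r) (2 * √2 * K * (1 - r) ^ (1 / Q - 1) - G' r) r := by
    intro r hr
    rw [interior_Icc] at hr
    exact (hBd r hr.2).sub (hGd r (by nlinarith [hr.1, hr.2]))
  have hmono : MonotoneOn (fun r => B r - G r) (Set.Icc 0 1) := by
    refine monotoneOn_of_deriv_nonneg (convex_Icc 0 1) (hBc.sub hGc).continuousOn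
      (fun r hr => (hd r hr).differentiableAt.differentiableWithinAt) fun r hr => ?_
    rw [(hd r hr).deriv]
    rw [interior_Icc] at hr
    exact sub_nonneg.2 (hG'le r hr.1.le hr.2)
  have h01 := hmono (Set.left_mem_Icc.2 zero_le_one) (Set.right_mem_Icc.2 zero_le_one) zero_le_one
  have hB0 : B 0 = -(2 * √2 * K * Q) := by simp [hB]
  have hB1 : B 1 = 0 := by
    have : Q⁻¹ ≠ 0 := inv_ne_zero (by linarith)
    simp [hB, zero_rpow this]
  have hG1 : G 1 = cubeMean fun x => φ x (f x) := by
    simp only [hG, productMean_biasedLaw_one, one_mul]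
  have hG0 : G 0 = cubeMean fun x => φ x (cubeMean f) := by
    simp only [hG, productMean_biasedLaw_zero]
    congr 1
    ext x
    refine (cubeMean_comp_equiv (Equiv.mulRight x) fun y => φ x (f y)).trans ?_
    simp only [cubeMean, map_smul, map_sum]
  have hfin : cubeMean (fun x => ‖f x - cubeMean f‖) = G 1 - G 0 := by
    rw [hG1, hG0, ← cubeMean_sub]
    congr 1
    ext x
    rw [← map_sub, hφx]
    rfl
  simp only [hB0, hB1] at h01
  linarith

end Noise

/-! ### Assembling the moment bounds -/

lemma HasCotypeWith.one_le {E : Type*} [NormedAddCommGroup E] [NormedSpace ℝ E] [Nontrivial E]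
    {Q K : ℝ} (h : HasCotypeWith E Q K) : 1 ≤ K := by
  obtain ⟨hQ, hK, hv⟩ := h
  obtain ⟨v, hv0⟩ := exists_ne (0 : E)
  have h1 := hv 1 fun _ => v
  have h2 : ∀ ε : HammingCube 1, ‖∑ i, ε i • v‖ ^ 2 = ‖v‖ ^ 2 := by
    intro ε
    rcases Int.units_eq_one_or (ε 0) with h | h <;> simp [h, Units.smul_def]
  simp only [h2, cubeMean_const, sqrt_sq (norm_nonneg v)] at h1
  simp only [Finset.univ_unique, Finset.sum_singleton] at h1
  rw [one_div, rpow_rpow_inv (norm_nonneg v) (by linarith)] at h1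
  have := norm_pos_iff.2 hv0
  nlinarith

lemma IsCubeLipschitz.centralMoment_le {E : Type*} [NormedAddCommGroup E] [NormedSpace ℝ E]
    {n : ℕ} {f : HammingCube n → E} {Q K p : ℝ} (hf : IsCubeLipschitz f)
    (hE : HasCotypeWith E Q K) (hp : 0 < p) :
    centralMoment f p ≤ exp 3 * (2 * √2 * (K * Q) + √p) :=
  cubeMean_rpow_le_of_gradient (fun x => hf.sum_sq_norm_sub_le (cubeMean f) x)
    (fun _ => norm_nonneg _) (hf.cubeMean_norm_sub_le hE) hp

lemma centralMoment_of_subsingleton {E : Type*} [NormedAddCommGroup E] [NormedSpace ℝ E]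
    [Subsingleton E] {n : ℕ} (f : HammingCube n → E) {p : ℝ} (hp : 0 < p) :
    centralMoment f p = 0 := by
  have h : ∀ x, ‖f x - cubeMean f‖ ^ p = 0 := fun x => by
    rw [Subsingleton.elim (f x - cubeMean f) 0, norm_zero, zero_rpow hp.ne']
  simp only [centralMoment, h, cubeMean_const]
  exact zero_rpow (by positivity)

theorem mainTheorem2 :
    ∃ C : ℝ, 0 < C ∧
      ∀ (E : Type*) [NormedAddCommGroup E] [NormedSpace ℝ E] [CompleteSpace E] (Q K : ℝ),
        HasCotypeWith E Q K →
          (∀ (n : ℕ) (f : HammingCube n → E), IsCubeLipschitz f → ∀ p : ℝ,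
            (1 ≤ p → p ≤ Q → centralMoment f p ≤ C * (K * Q)) ∧
            (Q ≤ p → centralMoment f p ≤ C * Real.sqrt (2 * p + K ^ 2 * Q ^ 2 - 2 * Q))) ∧
          ∃ p₀ : ℝ, ∀ (n : ℕ) (f : HammingCube n → E), IsCubeLipschitz f →
            ∀ p : ℝ, p₀ ≤ p → centralMoment f p ≤ C * Real.sqrt p := by
  refine ⟨exp 3 * (2 * √2 + 1), by positivity, fun E _ _ _ Q K hE => ?_⟩
  have hQ : 2 ≤ Q := hE.1
  have hK : 0 ≤ K := hE.2.1
  have bound : ∀ {a b t : ℝ}, a ≤ t → b ≤ t →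
      exp 3 * (2 * √2 * a + b) ≤ exp 3 * (2 * √2 + 1) * t := by
    intro a b t ha hb
    calc exp 3 * (2 * √2 * a + b) ≤ exp 3 * (2 * √2 * t + t) := by gcongr
      _ = _ := by ring
  -- The zero space admits `K = 0`, where `Q ≤ K * Q` fails; otherwise a single nonzero vector
  -- forces `K ≥ 1`.
  rcases subsingleton_or_nontrivial E with hs | hs
  · refine ⟨fun n f hf p => ⟨fun hp _ => ?_, fun hp => ?_⟩, 1, fun n f hf p hp => ?_⟩ <;>
    · rw [centralMoment_of_subsingleton f (by linarith)]
      positivity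
  · have hK1 : 1 ≤ K := hE.one_le
    have hKQ : Q ≤ K * Q := by nlinarith
    refine ⟨fun n f hf p => ⟨fun hp hpQ => ?_, fun hp => ?_⟩, max Q ((K * Q) ^ 2),
      fun n f hf p hp => ?_⟩
    · refine (hf.centralMoment_le hE (by linarith)).trans (bound le_rfl ?_)
      exact sqrt_le_iff.2 ⟨by positivity, by nlinarith⟩
    · refine (hf.centralMoment_le hE (by linarith)).trans (bound ?_ ?_)
      -- `p ≥ Q` makes the radicand at least `(K Q)²`; for the bound by `p` below, `K² Q² ≥ Q² ≥ 2
      -- Q` suffices.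
      · exact le_sqrt_of_sq_le (by nlinarith)
      · exact sqrt_le_sqrt (by nlinarith)
    · have h1 : 0 < p := by linarith [(le_max_left _ _).trans hp]
      exact (hf.centralMoment_le hE h1).trans
        (bound (le_sqrt_of_sq_le ((le_max_right _ _).trans hp)) le_rfl)
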